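/- Let $\mathcal X_n=\{X\in \mathrm{Sym}_n(\mathbb R): X>0,\ \det X=1\}$ carry the Riemannian metric $\langle A,B\rangle_X=\mathrm{tr}(X^{-1}AX^{-1}B)$, with Riemannian distance $d$, and let $\mathfrak s(X,Y)=\mathrm{tr}(X^{-1}Y)$. The standard Satake compactification consists of the projective classes of nonzero positive semidefinite symmetric matrices; for a nonzero positive semidefinite $\alpha$ the type-$0$ Busemann–Selberg function is $$\mathfrak b_{\alpha,X}(Y)=\lim_{A\in\mathcal X_n,\,[A]\to[\alpha]}\frac{\mathfrak s(Y,A)}{\mathfrak s(X,A)}=\frac{\mathrm{tr}(Y^{-1}\alpha)}{\mathrm{tr}(X^{-1}\alpha)}.$$ For a subspace $V\subseteq\mathbb R^n$ let $\partial_S(V)$ be the set of classes of positive semidefinite matrices with column space $V$; its boundary is the union of the $\partial_S(W)$ with $0\ne W\subsetneq V$. Let $0\le k\le n$, let $V\subseteq\mathbb R^n$ be a subspace of dimension $n-k$, $\Pi=\partial_S(V)$ (so $\Pi=\mathcal X_n$ when $k=0$), and let $\alpha$ be a point on the boundary of $\Pi$ (so $1\le\mathrm{rank}\,\alpha<n-k$).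 Let $\iota$ be an $n\times(n-k)$ matrix whose columns form an orthonormal basis of $V$, let $\pi(P)=\det(\iota^{\mathsf T}P\iota)^{-1/(n-k)}\,\iota^{\mathsf T}P\iota$ for $P\in\mathcal X_n$, and let $\pi(\alpha)=[\iota^{\mathsf T}\alpha\,\iota]$. For $X\in\mathcal X_n$, the type-$k$ Busemann–Selberg function based at $(\alpha,\Pi)$ with reference point $X$ is $$\mathfrak b^{(k)}_{\Pi;\alpha,X}(Y)=\mathfrak b_{\pi(\alpha),\,\pi(X^{-1})^{-1}}\bigl(\pi(Y^{-1})^{-1}\bigr),\qquad Y\in\mathcal X_n.$$ Then for all $X,Y_1,Y_2\in\mathcal X_n$, $$\bigl|\log \mathfrak b^{(k)}_{\Pi;\alpha,X}(Y_1)-\log \mathfrak b^{(k)}_{\Pi;\alpha,X}(Y_2)\bigr|\le\sqrt{\frac{n-k-1}{n-k}}\;d(Y_1,Y_2).$$ -/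

import Mathlib

open Filter Topology Set

noncomputable section

/-- The hypersurface model of `SL(n,ℝ)/SO(n)`: symmetric positive definite real `n × n` matrices of
determinant one (`Matrix.PosDef` includes symmetry). -/
def symSpace (n : ℕ) : Set (Matrix (Fin n) (Fin n) ℝ) :=
  {X | X.PosDef ∧ X.det = 1}

/-- `γ` is a `C¹` path `[0,1] → X_n` (entrywise `C¹`) from `Y₁` to `Y₂`. -/
structure IsSymSpacePath {n : ℕ} (γ : ℝ → Matrix (Fin n) (Fin n) ℝ)
    (Y₁ Y₂ : Matrix (Fin n) (Fin n) ℝ) : Prop where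
  mem : ∀ t ∈ Icc (0 : ℝ) 1, γ t ∈ symSpace n
  contDiff : ∀ i j, ContDiffOn ℝ 1 (fun t => γ t i j) (Icc 0 1)
  source : γ 0 = Y₁
  target : γ 1 = Y₂

/-- The velocity `γ'(t)` of a matrix-valued path on `[0,1]`. -/
def pathVelocity {n : ℕ} (γ : ℝ → Matrix (Fin n) (Fin n) ℝ) (t : ℝ) : Matrix (Fin n) (Fin n) ℝ :=
  Matrix.of fun i j => derivWithin (fun s => γ s i j) (Icc 0 1) t

/-- The Riemannian metric `⟨A, B⟩_X = tr (X⁻¹ A X⁻¹ B)`. -/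
def symSpaceInner {n : ℕ} (X A B : Matrix (Fin n) (Fin n) ℝ) : ℝ :=
  (X⁻¹ * A * X⁻¹ * B).trace

/-- The Riemannian length of a path parametrized by `[0,1]`. -/
def symSpaceLength {n : ℕ} (γ : ℝ → Matrix (Fin n) (Fin n) ℝ) : ℝ :=
  ∫ t in (0 : ℝ)..1, √(symSpaceInner (γ t) (pathVelocity γ t) (pathVelocity γ t))

/-- The Riemannian distance on `X_n`: the infimum of the lengths of the `C¹` paths in `X_n`. -/
def symSpaceDist {n : ℕ} (Y₁ Y₂ : Matrix (Fin n) (Fin n) ℝ) : ℝ :=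
  sInf {L : ℝ | ∃ γ, IsSymSpacePath γ Y₁ Y₂ ∧ symSpaceLength γ = L}

/-- The Selberg invariant `𝔰(X, Y) = tr (X⁻¹ Y)`. -/
def selbergInvariant {n : ℕ} (X Y : Matrix (Fin n) (Fin n) ℝ) : ℝ :=
  (X⁻¹ * Y).trace

/-- Matrices representing the points of the Satake boundary component `∂_S(V)`: the positive
semidefinite matrices with column space `V`. (For `V = ⊤` these are the representatives of the
points of `X_n` in the projective model.) -/
def satakeComponent {n : ℕ} (V : Submodule ℝ (Fin n → ℝ)) : Set (Matrix (Fin n) (Fin n) ℝ) :=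
  {A | A.PosSemidef ∧ LinearMap.range A.mulVecLin = V}

/-- Matrices representing the points of the boundary of `∂_S(V)`, the union of the components
`∂_S(W)` with `0 ≠ W ⊊ V`. -/
def satakeComponentBoundary {n : ℕ} (V : Submodule ℝ (Fin n → ℝ)) :
    Set (Matrix (Fin n) (Fin n) ℝ) :=
  ⋃ (W : Submodule ℝ (Fin n → ℝ)) (_ : W ≠ ⊥) (_ : W < V), satakeComponent W

/-- The filter on matrices of approaching, from within `X_n`, the point of the Satake
compactification represented by the nonzero positive semidefinite matrix `α`: a path `A(t)` in `X_n`
tends to it when `[A(t)] → [α]` projectively. Projective convergence is expressed through the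
representatives of trace one, which are unique for nonzero semidefinite matrices. -/
def satakeApproach {n : ℕ} (α : Matrix (Fin n) (Fin n) ℝ) : Filter (Matrix (Fin n) (Fin n) ℝ) :=
  comap (fun A => (A.trace)⁻¹ • A) (𝓝 ((α.trace)⁻¹ • α)) ⊓ 𝓟 (symSpace n)

/-- The (type `0`) Busemann–Selberg function based at `α` with reference point `X`:
`𝔟_{α,X}(Y) = lim 𝔰(Y, A) / 𝔰(X, A)` as `A ∈ X_n` tends to `α`. -/
def busemannSelberg {n : ℕ} (α X Y : Matrix (Fin n) (Fin n) ℝ) : ℝ :=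
  limUnder (satakeApproach α) fun A => selbergInvariant Y A / selbergInvariant X A

/-- The columns of `ι` form an orthonormal basis of `V`. -/
def IsOrthonormalFrame {n m : ℕ} (V : Submodule ℝ (Fin n → ℝ)) (ι : Matrix (Fin n) (Fin m) ℝ) :
    Prop :=
  ι.transpose * ι = 1 ∧ LinearMap.range ι.mulVecLin = V

/-- The projection `[A] ↦ [ιᵀ A ι]` associated to a boundary component, on representatives
(projective model). -/
def compression {n m : ℕ} (ι : Matrix (Fin n) (Fin m) ℝ) (A : Matrix (Fin n) (Fin n) ℝ) :
    Matrix (Fin m) (Fin m) ℝ :=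
  ι.transpose * A * ι

/-- The projection `π : X_n → X_m`, `A ↦ det(ιᵀ A ι)^{-1/m} ιᵀ A ι` (hypersurface model). -/
def normalizedCompression {n m : ℕ} (ι : Matrix (Fin n) (Fin m) ℝ)
    (A : Matrix (Fin n) (Fin n) ℝ) : Matrix (Fin m) (Fin m) ℝ :=
  ((compression ι A).det ^ ((m : ℝ)⁻¹))⁻¹ • compression ι A

/-- The higher type Busemann–Selberg function
`Y ↦ 𝔟_{π(α), π(X⁻¹)⁻¹}(π(Y⁻¹)⁻¹)`; its type is `k` when `m = n - k`. Here `ι` is an orthonormal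
frame of the subspace defining the boundary component. -/
def higherBusemannSelberg {n m : ℕ} (ι : Matrix (Fin n) (Fin m) ℝ)
    (α X Y : Matrix (Fin n) (Fin n) ℝ) : ℝ :=
  busemannSelberg (compression ι α) (normalizedCompression ι X⁻¹)⁻¹ (normalizedCompression ι Y⁻¹)⁻¹

/-- `tr (P α) > 0` for `P` positive definite and `α ≠ 0` positive semidefinite. -/
theorem trace_posDef_mul_pos {n : ℕ} {P α : Matrix (Fin n) (Fin n) ℝ} (hP : P.PosDef)
    (hα : α.PosSemidef) (h0 : α ≠ 0) : 0 < (P * α).trace := by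
  obtain ⟨B, rfl⟩ : ∃ B, P = Matrix.conjTranspose B * B := by
    open scoped MatrixOrder in
    exact CStarAlgebra.nonneg_iff_eq_star_mul_self.mp hP.posSemidef.nonneg
  obtain ⟨C, rfl⟩ : ∃ C, α = Matrix.conjTranspose C * C := by
    open scoped MatrixOrder in
    exact CStarAlgebra.nonneg_iff_eq_star_mul_self.mp hα.nonneg
  have e : (B.conjTranspose * B * (C.conjTranspose * C)).trace
      = ((B * C.conjTranspose).conjTranspose * (B * C.conjTranspose)).trace := by
    rw [Matrix.conjTranspose_mul, Matrix.conjTranspose_conjTranspose, Matrix.trace_mul_comm,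
      ← Matrix.mul_assoc, Matrix.mul_assoc C.conjTranspose, Matrix.mul_assoc C.conjTranspose,
      Matrix.trace_mul_comm]
    simp only [Matrix.mul_assoc]
  rw [e]
  refine lt_of_le_of_ne (Matrix.posSemidef_conjTranspose_mul_self _).trace_nonneg fun h => h0 ?_
  have h1 := Matrix.trace_conjTranspose_mul_self_eq_zero_iff.mp h.symm
  have hu : IsUnit B := by
    have := hP.isUnit
    rw [Matrix.isUnit_iff_isUnit_det, Matrix.det_mul] at this
    rw [Matrix.isUnit_iff_isUnit_det]
    exact isUnit_of_mul_isUnit_right this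
  have h2 : C.conjTranspose = 0 := hu.mul_right_eq_zero.mp h1
  rw [h2, Matrix.zero_mul]

theorem satakeApproach_neBot {n : ℕ} {α : Matrix (Fin n) (Fin n) ℝ} (hα : α.PosSemidef)
    (h0 : α ≠ 0) : (satakeApproach α).NeBot := by
  have hn : n ≠ 0 := by
    rintro rfl
    exact h0 (Subsingleton.elim _ _)
  have htr : 0 < α.trace := by
    simpa using trace_posDef_mul_pos Matrix.PosDef.one hα h0
  let B : ℝ → Matrix (Fin n) (Fin n) ℝ := fun ε => α + ε • 1
  let A : ℝ → Matrix (Fin n) (Fin n) ℝ := fun ε => ((B ε).det ^ ((n : ℝ)⁻¹))⁻¹ • B ε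
  have hB : ∀ ε : ℝ, 0 < ε → (B ε).PosDef := fun ε hε =>
    Matrix.PosDef.posSemidef_add hα (Matrix.PosDef.one.smul hε)
  have hc : ∀ ε : ℝ, 0 < ε → 0 < ((B ε).det ^ ((n : ℝ)⁻¹))⁻¹ := fun ε hε =>
    inv_pos.mpr (Real.rpow_pos_of_pos (hB ε hε).det_pos _)
  have key : Tendsto A (𝓝[>] 0) (satakeApproach α) := by
    refine tendsto_inf.mpr ⟨tendsto_comap_iff.mpr ?_, tendsto_principal.mpr ?_⟩
    · have hBc : Continuous B := by fun_prop
      have h1 : Tendsto (fun ε => (B ε).trace⁻¹ • B ε) (𝓝[>] 0) (𝓝 ((α.trace)⁻¹ • α)) := by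
        have hB0 : B 0 = α := by simp [B]
        have : ContinuousAt (fun ε => (B ε).trace⁻¹ • B ε) 0 := by
          have h3 : ContinuousAt (fun ε => (B ε).trace) 0 := hBc.matrix_trace.continuousAt
          exact (h3.inv₀ (by rw [hB0]; exact htr.ne')).smul hBc.continuousAt
        have h2 := this.tendsto
        simp only [hB0] at h2
        exact h2.mono_left nhdsWithin_le_nhds
      refine h1.congr' ?_
      filter_upwards [self_mem_nhdsWithin] with ε hε
      have := (hc ε hε).ne'
      simp only [A, Function.comp, Matrix.trace_smul, smul_smul, smul_eq_mul, mul_inv]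
      rw [mul_comm _ (B ε).trace⁻¹, mul_assoc, inv_mul_cancel₀ this, mul_one]
    · filter_upwards [self_mem_nhdsWithin] with ε hε
      refine ⟨(hB ε hε).smul (hc ε hε), ?_⟩
      simp only [A, Matrix.det_smul, Fintype.card_fin, inv_pow]
      rw [← Real.rpow_natCast, ← Real.rpow_mul (hB ε hε).det_pos.le,
        inv_mul_cancel₀ (by exact_mod_cast hn), Real.rpow_one,
        inv_mul_cancel₀ (hB ε hε).det_pos.ne']
  exact key.neBot

/-- The limit defining the type `0` Busemann–Selberg function exists. -/
theorem tendsto_busemannSelberg_aux {n : ℕ} {α X Y : Matrix (Fin n) (Fin n) ℝ}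
    (hα : α.PosSemidef) (h0 : α ≠ 0) (hX : X.PosDef) :
    Tendsto (fun A => selbergInvariant Y A / selbergInvariant X A) (satakeApproach α)
      (𝓝 ((Y⁻¹ * α).trace / (X⁻¹ * α).trace)) := by
  have hn : Nonempty (Fin n) := by
    by_contra h
    rw [not_nonempty_iff] at h
    exact h0 (Subsingleton.elim _ _)
  have htr : 0 < α.trace := by
    simpa using trace_posDef_mul_pos Matrix.PosDef.one hα h0
  have hd := trace_posDef_mul_pos hX.inv hα h0
  have hc : ∀ Z : Matrix (Fin n) (Fin n) ℝ,
      Tendsto (fun A => (Z⁻¹ * ((A.trace)⁻¹ • A)).trace) (satakeApproach α)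
        (𝓝 (Z⁻¹ * ((α.trace)⁻¹ • α)).trace) := by
    intro Z
    have h1 : Tendsto (fun A : Matrix (Fin n) (Fin n) ℝ => (A.trace)⁻¹ • A) (satakeApproach α)
        (𝓝 ((α.trace)⁻¹ • α)) := tendsto_comap.mono_left inf_le_left
    have h2 : Continuous fun A : Matrix (Fin n) (Fin n) ℝ => (Z⁻¹ * A).trace :=
      (continuous_const.matrix_mul continuous_id).matrix_trace
    exact (h2.tendsto _).comp h1
  have h3 := (hc Y).div (hc X) (by
    simp only [Matrix.mul_smul, Matrix.trace_smul, smul_eq_mul]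
    positivity)
  have e : ∀ A : Matrix (Fin n) (Fin n) ℝ, A.trace ≠ 0 →
      (Y⁻¹ * ((A.trace)⁻¹ • A)).trace / (X⁻¹ * ((A.trace)⁻¹ • A)).trace
        = (Y⁻¹ * A).trace / (X⁻¹ * A).trace := by
    intro A hA
    simp only [Matrix.mul_smul, Matrix.trace_smul, smul_eq_mul]
    rw [mul_div_mul_left _ _ (inv_ne_zero hA)]
  rw [e α htr.ne'] at h3
  refine h3.congr' ?_
  have hm : ∀ᶠ A in satakeApproach α, A ∈ symSpace n :=
    mem_inf_of_right (mem_principal_self _)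
  filter_upwards [hm] with A hA
  exact e A hA.1.trace_pos.ne'

/-- The closed form of the type `0` Busemann–Selberg function. -/
theorem busemannSelberg_eq {n : ℕ} {α X Y : Matrix (Fin n) (Fin n) ℝ}
    (hα : α.PosSemidef) (h0 : α ≠ 0) (hX : X.PosDef) :
    busemannSelberg α X Y = (Y⁻¹ * α).trace / (X⁻¹ * α).trace :=
  haveI := satakeApproach_neBot hα h0
  (tendsto_busemannSelberg_aux hα h0 hX).limUnder_eq

theorem compression_posDef {n m : ℕ} {V : Submodule ℝ (Fin n → ℝ)} {ι : Matrix (Fin n) (Fin m) ℝ}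
    (hι : IsOrthonormalFrame V ι) {P : Matrix (Fin n) (Fin n) ℝ} (hP : P.PosDef) :
    (compression ι P).PosDef := by
  have h := hP.conjTranspose_mul_mul_same (B := ι) (fun x y hxy => by
    have := congrArg (fun v => ι.transpose.mulVec v) hxy
    simpa [Matrix.mulVec_mulVec, hι.1] using this)
  simpa [compression, Matrix.conjTranspose_eq_transpose_of_trivial] using h

theorem normalizedCompression_mem {n m : ℕ} (hm : m ≠ 0) {V : Submodule ℝ (Fin n → ℝ)}
    {ι : Matrix (Fin n) (Fin m) ℝ} (hι : IsOrthonormalFrame V ι) {P : Matrix (Fin n) (Fin n) ℝ}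
    (hP : P.PosDef) : normalizedCompression ι P ∈ symSpace m := by
  have hC := compression_posDef hι hP
  refine ⟨hC.smul (inv_pos.mpr (Real.rpow_pos_of_pos hC.det_pos _)), ?_⟩
  simp only [normalizedCompression, Matrix.det_smul, Fintype.card_fin, inv_pow]
  rw [← Real.rpow_natCast, ← Real.rpow_mul hC.det_pos.le,
    inv_mul_cancel₀ (by exact_mod_cast hm), Real.rpow_one, inv_mul_cancel₀ hC.det_pos.ne']

/-- A point on the boundary of `∂_S(V)` is determined by its compression to `V`. -/
theorem compression_boundary {n m : ℕ} {V : Submodule ℝ (Fin n → ℝ)}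
    {ι : Matrix (Fin n) (Fin m) ℝ} (hι : IsOrthonormalFrame V ι) {α : Matrix (Fin n) (Fin n) ℝ}
    (hα : α ∈ satakeComponentBoundary V) :
    (compression ι α).PosSemidef ∧ compression ι α ≠ 0 ∧
      ι * compression ι α * ι.transpose = α := by
  simp only [satakeComponentBoundary, mem_iUnion] at hα
  obtain ⟨W, hW0, hWV, hpsd, hr⟩ := hα
  have h1 : ι * ι.transpose * α = α := by
    apply Matrix.toLin'.injective
    ext1 i
    apply LinearMap.ext
    intro c
    have hmem : α.mulVec (Pi.single i c) ∈ LinearMap.range ι.mulVecLin := by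
      rw [hι.2]
      exact hWV.le (hr ▸ LinearMap.mem_range_self α.mulVecLin _)
    obtain ⟨y, hy⟩ := hmem
    simp only [Matrix.mulVecLin_apply] at hy
    simp only [LinearMap.comp_apply, Matrix.toLin'_apply, LinearMap.single_apply]
    rw [← Matrix.mulVec_mulVec, ← hy, Matrix.mulVec_mulVec, Matrix.mul_assoc, hι.1, Matrix.mul_one]
  have ht : α.transpose = α := by
    simpa [Matrix.conjTranspose_eq_transpose_of_trivial] using hpsd.1.eq
  have h2 : α * (ι * ι.transpose) = α := by
    have := congrArg Matrix.transpose h1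
    simpa [Matrix.transpose_mul, ht, Matrix.mul_assoc] using this
  have h3 : ι * compression ι α * ι.transpose = α := by
    calc ι * compression ι α * ι.transpose = ι * ι.transpose * α * (ι * ι.transpose) := by
          simp only [compression, Matrix.mul_assoc]
      _ = α := by rw [h1, h2]
  refine ⟨?_, fun h => hW0 ?_, h3⟩
  · simpa [compression, Matrix.conjTranspose_eq_transpose_of_trivial] using
      hpsd.conjTranspose_mul_mul_same ι
  · rw [h, Matrix.mul_zero, Matrix.zero_mul] at h3
    rw [← hr, ← h3]
    simp

/-- The closed form of the higher type Busemann–Selberg function. -/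
theorem higherBusemannSelberg_eq {n m : ℕ} {V : Submodule ℝ (Fin n → ℝ)}
    {ι : Matrix (Fin n) (Fin m) ℝ} (hι : IsOrthonormalFrame V ι) {α X Y : Matrix (Fin n) (Fin n) ℝ}
    (hα : α ∈ satakeComponentBoundary V) (hX : X.PosDef) (hY : Y.PosDef) :
    higherBusemannSelberg ι α X Y =
      ((Y⁻¹ * α).trace * ((compression ι Y⁻¹).det ^ ((m : ℝ)⁻¹))⁻¹) /
        ((X⁻¹ * α).trace * ((compression ι X⁻¹).det ^ ((m : ℝ)⁻¹))⁻¹) := by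
  obtain ⟨h1, h2, h3⟩ := compression_boundary hι hα
  have hN : ∀ Z : Matrix (Fin n) (Fin n) ℝ, Z.PosDef → (normalizedCompression ι Z⁻¹).PosDef :=
    fun Z hZ => by
      have hC := compression_posDef hι hZ.inv
      exact hC.smul (inv_pos.mpr (Real.rpow_pos_of_pos hC.det_pos _))
  have hT : ∀ Z : Matrix (Fin n) (Fin n) ℝ, Z.PosDef →
      ((normalizedCompression ι Z⁻¹)⁻¹⁻¹ * compression ι α).trace
        = (Z⁻¹ * α).trace * ((compression ι Z⁻¹).det ^ ((m : ℝ)⁻¹))⁻¹ := by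
    intro Z hZ
    rw [Matrix.nonsing_inv_nonsing_inv _ (hN Z hZ).det_pos.ne'.isUnit, normalizedCompression,
      Matrix.smul_mul, Matrix.trace_smul, smul_eq_mul, mul_comm]
    congr 1
    conv_rhs => rw [← h3]
    rw [compression, Matrix.mul_assoc, Matrix.trace_mul_comm]
    conv_rhs => rw [Matrix.trace_mul_comm]
    rw [← Matrix.mul_assoc, Matrix.trace_mul_comm]
  rw [higherBusemannSelberg, busemannSelberg_eq h1 h2 (hN X hX).inv, hT X hX, hT Y hY]

/-- Busemann–Selberg functions take positive values. -/
theorem higherBusemannSelberg_pos {n m : ℕ} {V : Submodule ℝ (Fin n → ℝ)}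
    {ι : Matrix (Fin n) (Fin m) ℝ} (hι : IsOrthonormalFrame V ι) {α X Y : Matrix (Fin n) (Fin n) ℝ}
    (hα : α ∈ satakeComponentBoundary V) (hX : X.PosDef) (hY : Y.PosDef) :
    0 < higherBusemannSelberg ι α X Y := by
  obtain ⟨h1, h2, h3⟩ := compression_boundary hι hα
  have hN : ∀ Z : Matrix (Fin n) (Fin n) ℝ, Z.PosDef → (normalizedCompression ι Z⁻¹).PosDef :=
    fun Z hZ => by
      have hC := compression_posDef hι hZ.inv
      exact hC.smul (inv_pos.mpr (Real.rpow_pos_of_pos hC.det_pos _))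
  rw [higherBusemannSelberg, busemannSelberg_eq h1 h2 (hN X hX).inv]
  exact div_pos (trace_posDef_mul_pos (hN Y hY).inv.inv h1 h2)
    (trace_posDef_mul_pos (hN X hX).inv.inv h1 h2)

/-- For the identity frame the higher type function is the type `0` function. -/
theorem higherBusemannSelberg_one {n : ℕ} {α X Y : Matrix (Fin n) (Fin n) ℝ}
    (hX : X ∈ symSpace n) (hY : Y ∈ symSpace n) :
    higherBusemannSelberg (1 : Matrix (Fin n) (Fin n) ℝ) α X Y = busemannSelberg α X Y := by
  have hN : ∀ Z : Matrix (Fin n) (Fin n) ℝ, Z ∈ symSpace n →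
      (normalizedCompression 1 Z⁻¹)⁻¹ = Z := fun Z hZ => by
    have hu : IsUnit Z.det := hZ.1.det_pos.ne'.isUnit
    simp [normalizedCompression, compression, Matrix.det_nonsing_inv, hZ.2,
      Matrix.nonsing_inv_nonsing_inv _ hu]
  rw [higherBusemannSelberg, hN X hX, hN Y hY]
  simp [compression]

/-- Any two points of `X_n` are joined by a path, so `symSpaceDist` is the infimum of a nonempty
set. -/
theorem exists_isSymSpacePath {n : ℕ} {Y₁ Y₂ : Matrix (Fin n) (Fin n) ℝ} (h₁ : Y₁ ∈ symSpace n)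
    (h₂ : Y₂ ∈ symSpace n) : ∃ γ, IsSymSpacePath γ Y₁ Y₂ := by
  let L : ℝ → Matrix (Fin n) (Fin n) ℝ := fun t => (1 - t) • Y₁ + t • Y₂
  have hL : ∀ t ∈ Icc (0 : ℝ) 1, (L t).PosDef := by
    intro t ht
    rcases eq_or_lt_of_le ht.1 with h | h
    · simpa [L, ← h] using h₁.1
    · exact Matrix.PosDef.posSemidef_add (h₁.1.posSemidef.smul (by linarith [ht.2])) (h₂.1.smul h)
  have hLc : ∀ i j, ContDiff ℝ 1 fun t => L t i j := by
    intro i j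
    simp only [L, Matrix.add_apply, Matrix.smul_apply, smul_eq_mul]
    fun_prop
  have hdet : ContDiff ℝ 1 fun t => (L t).det := by
    simp only [Matrix.det_apply']
    exact ContDiff.sum fun σ _ => contDiff_const.mul (contDiff_prod fun i _ => hLc _ _)
  refine ⟨fun t => ((L t).det ^ ((n : ℝ)⁻¹))⁻¹ • L t, ⟨fun t ht => ?_, fun i j => ?_, ?_, ?_⟩⟩
  · have hp := (hL t ht).det_pos
    refine ⟨(hL t ht).smul (inv_pos.mpr (Real.rpow_pos_of_pos hp _)), ?_⟩
    rcases eq_or_ne n 0 with rfl | hn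
    · exact Matrix.det_isEmpty
    simp only [Matrix.det_smul, Fintype.card_fin, inv_pow]
    rw [← Real.rpow_natCast, ← Real.rpow_mul hp.le, inv_mul_cancel₀ (by exact_mod_cast hn),
      Real.rpow_one, inv_mul_cancel₀ hp.ne']
  · simp only [Matrix.smul_apply, smul_eq_mul]
    refine ContDiffOn.mul (ContDiffOn.inv (hdet.contDiffOn.rpow_const_of_ne ?_) ?_)
      (hLc i j).contDiffOn
    · exact fun t ht => (hL t ht).det_pos.ne'
    · exact fun t ht => (Real.rpow_pos_of_pos (hL t ht).det_pos _).ne'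
  · simp [L, h₁.2]
  · simp [L, h₂.2]

end

/-! Put `m = n - k`, `P = Y⁻¹`, `C = ιᵀPι`. Up to a constant depending only on `X`, the logarithm of
the Busemann–Selberg function is `log tr(Pα) - (1/m) log det C`. Along a path with velocity `A` one
has `P' = -PAP`, and the derivative becomes `-tr(PAPE) = -⟨A, E⟩_Y`, where `E = α / tr(Pα) - F / m`
and `F = ι C⁻¹ ιᵀ`. So `-E` is the Riemannian gradient, and its norm is the Lipschitz constant
sought. Since `FP` is the `P`-orthogonal projection onto `V`, which contains the column space of
`α`, the cross terms simplify and `‖E‖² = tr(PαPα) / tr(Pα)² - 1/m`. The quotient is at most 1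
because `tr Q² ≤ (tr Q)²` for positive semidefinite `Q`, so `‖E‖² ≤ (m-1)/m`. Cauchy–Schwarz gives
the pointwise bound `abs_logDeriv_le`; `abs_sub_le_length` integrates it along a path, and the
infimum over paths finishes. -/

/-! ### Derivatives of determinant and inverse along matrix curves. -/

open scoped Matrix.Norms.Operator in
/-- Jacobi's formula along a curve of matrices, at a point where the matrix is invertible. -/
theorem hasDerivAt_matrix_det {m : ℕ} {C : ℝ → Matrix (Fin m) (Fin m) ℝ}
    {C' : Matrix (Fin m) (Fin m) ℝ} {t : ℝ} (hC : HasDerivAt C C' t) (hu : IsUnit (C t).det) :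
    HasDerivAt (fun s => (C s).det) ((C t).det * ((C t)⁻¹ * C').trace) t := by
  have hdiff : Differentiable ℝ (Matrix.det : Matrix (Fin m) (Fin m) ℝ → ℝ) := by
    have he : ∀ i j, Differentiable ℝ fun M : Matrix (Fin m) (Fin m) ℝ => M i j := fun i j =>
      (LinearMap.toContinuousLinearMap (Matrix.entryLinearMap ℝ ℝ i j)).differentiable
    have : (Matrix.det : Matrix (Fin m) (Fin m) ℝ → ℝ)
        = fun M => ∑ σ : Equiv.Perm (Fin m), ((Equiv.Perm.sign σ : ℤ) : ℝ) * ∏ i, M (σ i) i :=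
      funext fun M => Matrix.det_apply' M
    rw [this]
    fun_prop
  have hone : ∀ M : Matrix (Fin m) (Fin m) ℝ,
      fderiv ℝ (Matrix.det : Matrix (Fin m) (Fin m) ℝ → ℝ) 1 M = M.trace := by
    intro M
    have h1 : HasDerivAt (fun x : ℝ => (1 : Matrix (Fin m) (Fin m) ℝ) + x • M) M 0 := by
      have h := ((hasDerivAt_id (0 : ℝ)).smul_const M).const_add 1
      rw [one_smul] at h
      exact h
    have h2 : HasDerivAt (fun x : ℝ => (1 + x • M).det)
        (fderiv ℝ (Matrix.det : Matrix (Fin m) (Fin m) ℝ → ℝ) 1 M) 0 := by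
      have e0 : (1 : Matrix (Fin m) (Fin m) ℝ) + (0 : ℝ) • M = 1 := by simp
      exact HasFDerivAt.comp_hasDerivAt (0 : ℝ) (e0.symm ▸ (hdiff 1).hasFDerivAt) h1
    -- `det (1 + xM)` is a polynomial in `x` whose linear coefficient is `tr M`.
    let p : Polynomial ℝ := (1 + (Polynomial.X : Polynomial ℝ) • M.map Polynomial.C).det
    have h4 : (fun x : ℝ => (1 + x • M).det) = fun x => p.eval x := by
      funext x
      simp only [p]
      rw [← Polynomial.coe_evalRingHom, RingHom.map_det]
      congr 1
      ext i j
      by_cases hij : i = j <;> simp [hij, mul_comm x]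
    rw [h4] at h2
    rw [h2.unique (p.hasDerivAt 0)]
    exact Matrix.derivative_det_one_add_X_smul M
  -- Multiplying by `(C t)⁻¹` moves the base point to the identity, where the derivative of `det` is
  -- the trace.
  have hN : HasDerivAt (fun s => (C t)⁻¹ * C s) ((C t)⁻¹ * C') t := hC.const_mul _
  have h5 : HasDerivAt (fun s => ((C t)⁻¹ * C s).det) ((C t)⁻¹ * C').trace t := by
    rw [← hone]
    exact HasFDerivAt.comp_hasDerivAt t
      ((Matrix.nonsing_inv_mul _ hu).symm ▸ (hdiff 1).hasFDerivAt) hN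
  have h7 := h5.const_mul (C t).det
  refine h7.congr_of_eventuallyEq (Eventually.of_forall fun s => ?_)
  change (C s).det = (C t).det * ((C t)⁻¹ * C s).det
  rw [← Matrix.det_mul, ← Matrix.mul_assoc, Matrix.mul_nonsing_inv _ hu, Matrix.one_mul]

-- The operator norm makes the matrices a complete normed algebra, so the derivative of
-- `Ring.inverse` at a unit applies.
open scoped Matrix.Norms.Operator in
theorem hasDerivAt_matrix_inv {n : ℕ} {γ : ℝ → Matrix (Fin n) (Fin n) ℝ}
    {A : Matrix (Fin n) (Fin n) ℝ} {t : ℝ} (hγ : HasDerivAt γ A t) (hu : IsUnit (γ t).det) :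
    HasDerivAt (fun s => (γ s)⁻¹) (-((γ t)⁻¹ * A * (γ t)⁻¹)) t := by
  have hU : IsUnit (γ t) := (Matrix.isUnit_iff_isUnit_det _).mpr hu
  obtain ⟨u, hu'⟩ := hU
  have h := hasFDerivAt_ringInverse (𝕜 := ℝ) u
  rw [hu'] at h
  have h2 := h.comp_hasDerivAt t hγ
  have e : (u⁻¹ : (Matrix (Fin n) (Fin n) ℝ)ˣ) = (γ t)⁻¹ := by
    rw [Matrix.coe_units_inv, hu']
  simp only [e] at h2
  have e2 : (Ring.inverse ∘ γ) = fun s => (γ s)⁻¹ :=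
    funext fun s => (Matrix.nonsing_inv_eq_ringInverse (γ s)).symm
  rw [e2] at h2
  simp only [_root_.neg_apply, ContinuousLinearMap.mulLeftRight_apply] at h2
  exact h2

/-! ### Trace inequalities. -/

/-- The Cauchy–Schwarz inequality for the trace form on symmetric matrices. -/
theorem trace_mul_sq_le {n : ℕ} {M N : Matrix (Fin n) (Fin n) ℝ} (hM : M.transpose = M)
    (hN : N.transpose = N) : (M * N).trace ^ 2 ≤ (M * M).trace * (N * N).trace := by
  have e : ∀ K L : Matrix (Fin n) (Fin n) ℝ, L.transpose = L →
      (K * L).trace = ∑ p : Fin n × Fin n, K p.1 p.2 * L p.1 p.2 := by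
    intro K L hL
    rw [Fintype.sum_prod_type]
    simp only [Matrix.trace, Matrix.diag_apply, Matrix.mul_apply]
    refine Finset.sum_congr rfl fun i _ => Finset.sum_congr rfl fun j _ => ?_
    conv_lhs => rw [← hL, Matrix.transpose_apply]
  rw [e M N hN, e M M hM, e N N hN]
  simpa only [pow_two] using Finset.sum_mul_sq_le_sq_mul_sq Finset.univ
    (fun p : Fin n × Fin n => M p.1 p.2) (fun p => N p.1 p.2)

theorem exists_eq_transpose_mul_self {n : ℕ} {Q : Matrix (Fin n) (Fin n) ℝ} (hQ : Q.PosSemidef) :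
    ∃ B : Matrix (Fin n) (Fin n) ℝ, Q = B.transpose * B := by
  obtain ⟨B, h⟩ : ∃ B, Q = Matrix.conjTranspose B * B := by
    open scoped MatrixOrder in
    exact CStarAlgebra.nonneg_iff_eq_star_mul_self.mp hQ.nonneg
  exact ⟨B, by rw [h, Matrix.conjTranspose_eq_transpose_of_trivial]⟩

/-- Writing `Q` as a Gram matrix `RᵀR`, Cauchy–Schwarz on the columns of `R` gives `Q i j ^ 2 ≤ Q i
i * Q j j`; summing over `i, j` gives the bound without eigenvalues. -/
theorem trace_mul_self_le_trace_sq {n : ℕ} {Q : Matrix (Fin n) (Fin n) ℝ} (hQ : Q.PosSemidef) :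
    (Q * Q).trace ≤ Q.trace ^ 2 := by
  obtain ⟨R, rfl⟩ := exists_eq_transpose_mul_self hQ
  have hs : ∀ i j, (R.transpose * R) i j = (R.transpose * R) j i := by
    intro i j
    simp only [Matrix.mul_apply, Matrix.transpose_apply]
    exact Finset.sum_congr rfl fun k _ => mul_comm _ _
  simp only [pow_two, Matrix.trace, Matrix.diag_apply]
  rw [Finset.sum_mul_sum]
  refine Finset.sum_le_sum fun i _ => ?_
  rw [Matrix.mul_apply]
  refine Finset.sum_le_sum fun j _ => ?_
  rw [hs j i, ← pow_two]
  simp only [Matrix.mul_apply, Matrix.transpose_apply]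
  simpa only [pow_two] using Finset.sum_mul_sq_le_sq_mul_sq Finset.univ
    (fun k => R k i) (fun k => R k j)

/-- `⟨A, E⟩² ≤ ⟨A, A⟩ ⟨E, E⟩` for the inner product `tr (P A P E)` on symmetric matrices. -/
theorem trace_weighted_mul_sq_le {n : ℕ} {P A E : Matrix (Fin n) (Fin n) ℝ} (hP : P.PosSemidef)
    (hA : A.transpose = A) (hE : E.transpose = E) :
    (P * A * P * E).trace ^ 2 ≤ (P * A * P * A).trace * (P * E * P * E).trace := by
  obtain ⟨B, rfl⟩ := exists_eq_transpose_mul_self hP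
  -- With `P = BᵀB`, the map `K ↦ B K Bᵀ` carries the weighted form to the plain trace form.
  have e : ∀ K L : Matrix (Fin n) (Fin n) ℝ,
      (B.transpose * B * K * (B.transpose * B) * L).trace
        = (B * K * B.transpose * (B * L * B.transpose)).trace := by
    intro K L
    rw [← Matrix.mul_assoc (B * K * B.transpose), Matrix.trace_mul_comm _ B.transpose]
    simp only [Matrix.mul_assoc]
  have hs : ∀ K : Matrix (Fin n) (Fin n) ℝ, K.transpose = K →
      (B * K * B.transpose).transpose = B * K * B.transpose := by
    intro K hK
    simp only [Matrix.transpose_mul, Matrix.transpose_transpose, hK, Matrix.mul_assoc]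
  rw [e, e, e]
  exact trace_mul_sq_le (hs A hA) (hs E hE)

/-- With `P = BᵀB`, this is `trace_mul_self_le_trace_sq` for `Q = B α Bᵀ`. It bounds the `α` part of
the gradient norm. -/
theorem trace_mul_mul_mul_le_sq {n : ℕ} {P α : Matrix (Fin n) (Fin n) ℝ} (hP : P.PosSemidef)
    (hα : α.PosSemidef) : (P * α * P * α).trace ≤ (P * α).trace ^ 2 := by
  obtain ⟨B, rfl⟩ := exists_eq_transpose_mul_self hP
  have hQ : (B * α * B.transpose).PosSemidef := by
    simpa [Matrix.conjTranspose_eq_transpose_of_trivial] using hα.mul_mul_conjTranspose_same B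
  have h := trace_mul_self_le_trace_sq hQ
  have e1 : (B * α * B.transpose).trace = (B.transpose * B * α).trace := by
    rw [Matrix.trace_mul_comm]
    simp only [Matrix.mul_assoc]
  have e2 : (B * α * B.transpose * (B * α * B.transpose)).trace
      = (B.transpose * B * α * (B.transpose * B) * α).trace := by
    rw [← Matrix.mul_assoc (B * α * B.transpose), Matrix.trace_mul_comm _ B.transpose]
    simp only [Matrix.mul_assoc]
  rwa [e1, e2] at h

/-! ### The gradient bound. -/

/-- The infinitesimal form of the Lipschitz estimate. -/
theorem abs_logDeriv_le {n m : ℕ} (hm : m ≠ 0) {ι : Matrix (Fin n) (Fin m) ℝ}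
    {P A α : Matrix (Fin n) (Fin n) ℝ} (hP : P.PosDef) (hA : A.transpose = A)
    (hα : α.PosSemidef) (h0 : α ≠ 0) (hια : ι * compression ι α * ι.transpose = α)
    (hC : (compression ι P).PosDef) :
    |(-(P * A * P) * α).trace / (P * α).trace
        - (m : ℝ)⁻¹ * ((compression ι P)⁻¹ * compression ι (-(P * A * P))).trace|
      ≤ √(((m : ℝ) - 1) / m) * √(P * A * P * A).trace := by
  have hm' : (m : ℝ) ≠ 0 := by exact_mod_cast hm
  have hpos := trace_posDef_mul_pos hP hα h0
  set r := (P * α).trace with hr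
  set C := compression ι P with hCdef
  have hu : IsUnit C.det := hC.det_pos.ne'.isUnit
  have hαt : α.transpose = α := by
    simpa [Matrix.conjTranspose_eq_transpose_of_trivial] using hα.1.eq
  have hCt : C.transpose = C := by
    simpa [Matrix.conjTranspose_eq_transpose_of_trivial] using hC.1.eq
  -- `F * P` is the projection onto the range of `ι`, orthogonal for the inner product defined by
  -- `P`: it fixes `ι` and `α`, and its trace is `m`.
  set F := ι * C⁻¹ * ι.transpose with hF
  have hFt : F.transpose = F := by
    simp only [hF, Matrix.transpose_mul, Matrix.transpose_transpose, Matrix.transpose_nonsing_inv,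
      hCt, Matrix.mul_assoc]
  have hFP : F * P * ι = ι := by
    calc F * P * ι = ι * (C⁻¹ * C) := by
          simp only [hF, hCdef, compression, Matrix.mul_assoc]
      _ = ι := by rw [Matrix.nonsing_inv_mul _ hu, Matrix.mul_one]
  have hFα : F * P * α = α := by
    rw [← hια]
    simp only [← Matrix.mul_assoc]
    rw [hFP]
  have hFF : F * P * F = F := by
    nth_rw 2 [hF]
    rw [← Matrix.mul_assoc, ← Matrix.mul_assoc, hFP]
  have hPF : (P * F).trace = m := by
    rw [hF, ← Matrix.mul_assoc, Matrix.trace_mul_comm, ← Matrix.mul_assoc, ← Matrix.mul_assoc]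
    change (C * C⁻¹).trace = m
    rw [Matrix.mul_nonsing_inv _ hu, Matrix.trace_one, Fintype.card_fin]
  -- Minus the gradient: the derivative in the direction `A` is `-tr(PAPE)`.
  set E := r⁻¹ • α - (m : ℝ)⁻¹ • F with hE
  have hEt : E.transpose = E := by
    simp only [hE, Matrix.transpose_sub, Matrix.transpose_smul, hαt, hFt]
  have hlhs : (-(P * A * P) * α).trace / r
        - (m : ℝ)⁻¹ * (C⁻¹ * compression ι (-(P * A * P))).trace = -(P * A * P * E).trace := by
    have h1 : (C⁻¹ * compression ι (-(P * A * P))).trace = -(P * A * P * F).trace := by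
      rw [Matrix.trace_mul_comm (P * A * P) F, hF, compression]
      rw [Matrix.mul_assoc ι, Matrix.mul_assoc ι, Matrix.trace_mul_comm ι]
      simp only [Matrix.mul_neg, Matrix.neg_mul, Matrix.trace_neg, Matrix.mul_assoc]
    rw [h1, hE, Matrix.mul_sub, Matrix.mul_smul, Matrix.mul_smul, Matrix.trace_sub,
      Matrix.trace_smul, Matrix.trace_smul, Matrix.neg_mul, Matrix.trace_neg]
    simp only [smul_eq_mul]
    ring
  have hαF : (P * α * (P * F)).trace = r := by
    rw [Matrix.trace_mul_comm, Matrix.mul_assoc, ← Matrix.mul_assoc F, hFα]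
  have hFα' : (P * F * (P * α)).trace = r := by
    rw [Matrix.trace_mul_comm, hαF]
  have hFF' : (P * F * (P * F)).trace = m := by
    rw [Matrix.mul_assoc, ← Matrix.mul_assoc F, hFF, hPF]
  have hEE : (P * E * P * E).trace ≤ ((m : ℝ) - 1) / m := by
    -- The two cross terms contribute `-2/m` and the `F`-term `+1/m`.
    have h1 : (P * E * P * E).trace = (P * α * (P * α)).trace / r ^ 2 - (m : ℝ)⁻¹ := by
      rw [Matrix.mul_assoc (P * E), hE]
      simp only [Matrix.mul_sub, Matrix.sub_mul, Matrix.mul_smul, Matrix.smul_mul,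
        Matrix.trace_sub, Matrix.trace_smul, smul_eq_mul, hαF, hFα', hFF']
      field_simp
      ring
    have h2 := trace_mul_mul_mul_le_sq hP.posSemidef hα
    rw [Matrix.mul_assoc (P * α)] at h2
    have h3 : (P * α * (P * α)).trace / r ^ 2 ≤ 1 := by
      rw [div_le_one (by positivity)]
      exact h2
    rw [h1, sub_div, div_self hm', one_div]
    linarith
  have hAA : 0 ≤ (P * A * P * A).trace := by
    obtain ⟨B, rfl⟩ := exists_eq_transpose_mul_self hP.posSemidef
    have h := (Matrix.posSemidef_conjTranspose_mul_self (B * A * B.transpose)).trace_nonneg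
    rw [Matrix.conjTranspose_eq_transpose_of_trivial] at h
    simp only [Matrix.transpose_mul, Matrix.transpose_transpose, hA] at h
    rw [← Matrix.mul_assoc, ← Matrix.mul_assoc, Matrix.trace_mul_comm _ B.transpose] at h
    simpa only [Matrix.mul_assoc] using h
  rw [hlhs, abs_neg, ← Real.sqrt_mul' _ hAA]
  refine Real.abs_le_sqrt ((trace_weighted_mul_sq_le hP.posSemidef hA hEt).trans ?_)
  rw [mul_comm]
  exact mul_le_mul_of_nonneg_right hEE hAA

/-! ### Integration along paths. -/

open scoped Matrix.Norms.Operator in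
theorem continuousOn_matrix_inv {m : ℕ} {C : ℝ → Matrix (Fin m) (Fin m) ℝ} {s : Set ℝ}
    (hC : ContinuousOn C s) (hu : ∀ t ∈ s, IsUnit (C t).det) :
    ContinuousOn (fun t => (C t)⁻¹) s := by
  intro t ht
  obtain ⟨u, hu'⟩ := (Matrix.isUnit_iff_isUnit_det _).mpr (hu t ht)
  have h := NormedRing.inverse_continuousAt u
  rw [hu'] at h
  simp only [Matrix.nonsing_inv_eq_ringInverse]
  exact h.comp_continuousWithinAt (hC t ht)

namespace IsSymSpacePath

variable {n : ℕ} {γ : ℝ → Matrix (Fin n) (Fin n) ℝ} {Y₁ Y₂ : Matrix (Fin n) (Fin n) ℝ}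

theorem continuousOn (h : IsSymSpacePath γ Y₁ Y₂) : ContinuousOn γ (Icc 0 1) :=
  continuousOn_pi.mpr fun i => continuousOn_pi.mpr fun j => (h.contDiff i j).continuousOn

theorem continuousOn_velocity (h : IsSymSpacePath γ Y₁ Y₂) :
    ContinuousOn (pathVelocity γ) (Icc 0 1) :=
  continuousOn_pi.mpr fun i => continuousOn_pi.mpr fun j =>
    (h.contDiff i j).continuousOn_derivWithin (uniqueDiffOn_Icc zero_lt_one) le_rfl

-- Paths are only entrywise `C¹`; expansion in matrix units assembles the entries into a
-- matrix-valued derivative. In the open interval `derivWithin` is the two-sided derivative.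
open scoped Matrix.Norms.Operator in
theorem hasDerivAt (h : IsSymSpacePath γ Y₁ Y₂) {t : ℝ} (ht : t ∈ Ioo (0 : ℝ) 1) :
    HasDerivAt γ (pathVelocity γ t) t := by
  have hent : ∀ i j, HasDerivAt (fun s => γ s i j) (pathVelocity γ t i j) t := fun i j =>
    ((h.contDiff i j).differentiableOn one_ne_zero t
      (Ioo_subset_Icc_self ht)).hasDerivWithinAt.hasDerivAt (Icc_mem_nhds ht.1 ht.2)
  have hsum : HasDerivAt (fun s => ∑ i, ∑ j, γ s i j • Matrix.single i j (1 : ℝ))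
      (∑ i, ∑ j, pathVelocity γ t i j • Matrix.single i j (1 : ℝ)) t :=
    HasDerivAt.fun_sum fun i _ => HasDerivAt.fun_sum fun j _ => (hent i j).smul_const _
  have e : ∀ M : Matrix (Fin n) (Fin n) ℝ, ∑ i, ∑ j, M i j • Matrix.single i j (1 : ℝ) = M := by
    intro M
    conv_rhs => rw [Matrix.matrix_eq_sum_single M]
    simp
  simpa only [e] using hsum

theorem velocity_transpose (h : IsSymSpacePath γ Y₁ Y₂) {t : ℝ} (ht : t ∈ Icc (0 : ℝ) 1) :
    (pathVelocity γ t).transpose = pathVelocity γ t := by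
  ext i j
  simp only [pathVelocity, Matrix.transpose_apply, Matrix.of_apply]
  refine derivWithin_congr (fun s hs => ?_) ?_
  · simpa using (h.mem s hs).1.1.apply j i |>.symm
  · simpa using (h.mem t ht).1.1.apply j i |>.symm

open scoped Matrix.Norms.Operator in
theorem abs_sub_le_length {m : ℕ} (hm : m ≠ 0) {V : Submodule ℝ (Fin n → ℝ)}
    {ι : Matrix (Fin n) (Fin m) ℝ} (hι : IsOrthonormalFrame V ι)
    {α : Matrix (Fin n) (Fin n) ℝ} (hα : α.PosSemidef) (h0 : α ≠ 0)
    (hια : ι * compression ι α * ι.transpose = α) (h : IsSymSpacePath γ Y₁ Y₂) :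
    |(Real.log (Y₁⁻¹ * α).trace - (m : ℝ)⁻¹ * Real.log (compression ι Y₁⁻¹).det)
        - (Real.log (Y₂⁻¹ * α).trace - (m : ℝ)⁻¹ * Real.log (compression ι Y₂⁻¹).det)|
      ≤ √(((m : ℝ) - 1) / m) * symSpaceLength γ := by
  let P : ℝ → Matrix (Fin n) (Fin n) ℝ := fun t => (γ t)⁻¹
  let P' : ℝ → Matrix (Fin n) (Fin n) ℝ := fun t => -(P t * pathVelocity γ t * P t)
  let f : ℝ → ℝ := fun t =>
    Real.log (P t * α).trace - (m : ℝ)⁻¹ * Real.log (compression ι (P t)).det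
  let f' : ℝ → ℝ := fun t => (P' t * α).trace / (P t * α).trace
    - (m : ℝ)⁻¹ * ((compression ι (P t))⁻¹ * compression ι (P' t)).trace
  have hP : ∀ t ∈ Icc (0 : ℝ) 1, (P t).PosDef := fun t ht => (h.mem t ht).1.inv
  have hC : ∀ t ∈ Icc (0 : ℝ) 1, (compression ι (P t)).PosDef := fun t ht =>
    compression_posDef hι (hP t ht)
  have hcγ := h.continuousOn
  have hcv := h.continuousOn_velocity
  have hcP : ContinuousOn P (Icc 0 1) :=
    continuousOn_matrix_inv hcγ fun t ht => (h.mem t ht).1.det_pos.ne'.isUnit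
  have hcomp : Continuous fun M : Matrix (Fin n) (Fin n) ℝ => compression ι M := by
    unfold compression
    fun_prop
  have htr : Continuous fun M : Matrix (Fin n) (Fin n) ℝ => (M * α).trace := by
    fun_prop
  have hcP' : ContinuousOn P' (Icc 0 1) := ((hcP.mul hcv).mul hcP).neg
  have hcC : ContinuousOn (fun t => compression ι (P t)) (Icc 0 1) := hcomp.comp_continuousOn hcP
  have hcC' : ContinuousOn (fun t => compression ι (P' t)) (Icc 0 1) :=
    hcomp.comp_continuousOn hcP'
  have htrpos : ∀ t ∈ Icc (0 : ℝ) 1, (P t * α).trace ≠ 0 := fun t ht =>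
    (trace_posDef_mul_pos (hP t ht) hα h0).ne'
  have hcT := htr.comp_continuousOn hcP
  have hcf : ContinuousOn f (Icc 0 1) :=
    (hcT.log htrpos).sub
      (continuousOn_const.mul (((Continuous.matrix_det continuous_id).comp_continuousOn hcC).log
        fun t ht => (hC t ht).det_pos.ne'))
  have hcf' : ContinuousOn f' (Icc 0 1) := by
    refine ((htr.comp_continuousOn hcP').div hcT htrpos).sub (continuousOn_const.mul ?_)
    exact (Continuous.matrix_trace continuous_id).comp_continuousOn
      ((continuousOn_matrix_inv hcC fun t ht => (hC t ht).det_pos.ne'.isUnit).mul hcC')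
  have hderiv : ∀ t ∈ Ioo (0 : ℝ) 1, HasDerivAt f (f' t) t := by
    intro t ht
    have ht' := Ioo_subset_Icc_self ht
    have hdP : HasDerivAt P (P' t) t :=
      hasDerivAt_matrix_inv (h.hasDerivAt ht) (h.mem t ht').1.det_pos.ne'.isUnit
    have hdC : HasDerivAt (fun s => compression ι (P s)) (compression ι (P' t)) t := by
      let l : Matrix (Fin n) (Fin n) ℝ →ₗ[ℝ] Matrix (Fin m) (Fin m) ℝ :=
        { toFun := compression ι
          map_add' := fun M N => by simp [compression, Matrix.mul_add, Matrix.add_mul]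
          map_smul' := fun c M => by simp [compression] }
      exact (LinearMap.toContinuousLinearMap l).hasFDerivAt.comp_hasDerivAt t hdP
    have hdT : HasDerivAt (fun s => (P s * α).trace) (P' t * α).trace t := by
      let l : Matrix (Fin n) (Fin n) ℝ →ₗ[ℝ] ℝ :=
        { toFun := fun M => (M * α).trace
          map_add' := fun M N => by simp [Matrix.add_mul]
          map_smul' := fun c M => by simp }
      exact (LinearMap.toContinuousLinearMap l).hasFDerivAt.comp_hasDerivAt t hdP
    have hdet := hasDerivAt_matrix_det hdC (hC t ht').det_pos.ne'.isUnit
    have hd := (hdT.log (htrpos t ht')).sub ((hdet.log (hC t ht').det_pos.ne').const_mul (m : ℝ)⁻¹)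
    rwa [mul_div_cancel_left₀ _ (hC t ht').det_pos.ne'] at hd
  have hint : IntervalIntegrable f' MeasureTheory.volume 0 1 :=
    ContinuousOn.intervalIntegrable_of_Icc zero_le_one hcf'
  have hcs : ContinuousOn
      (fun t => √(symSpaceInner (γ t) (pathVelocity γ t) (pathVelocity γ t))) (Icc 0 1) :=
    ((Continuous.matrix_trace continuous_id).comp_continuousOn
      (((hcP.mul hcv).mul hcP).mul hcv)).sqrt
  -- This form asks for the derivative only inside the interval and for continuity of `f` up to the
  -- endpoints.
  have hFTC := intervalIntegral.integral_eq_sub_of_hasDerivAt_of_le zero_le_one hcf hderiv hint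
  have e : (Real.log (Y₁⁻¹ * α).trace - (m : ℝ)⁻¹ * Real.log (compression ι Y₁⁻¹).det)
        - (Real.log (Y₂⁻¹ * α).trace - (m : ℝ)⁻¹ * Real.log (compression ι Y₂⁻¹).det)
      = f 0 - f 1 := by
    simp only [f, P, h.source, h.target]
  rw [e, abs_sub_comm, ← hFTC, symSpaceLength, ← intervalIntegral.integral_const_mul]
  refine (intervalIntegral.abs_integral_le_integral_abs zero_le_one).trans
    (intervalIntegral.integral_mono_on zero_le_one hint.abs ?_ fun t ht => ?_)
  · exact (ContinuousOn.intervalIntegrable_of_Icc zero_le_one hcs).const_mul _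
  · exact abs_logDeriv_le hm (hP t ht) (h.velocity_transpose ht) hα h0 hια (hC t ht)

end IsSymSpacePath

/-! ### Passage to the distance. -/

/-- The reference point enters only through an additive constant, which cancels in differences. -/
theorem log_higherBusemannSelberg {n m : ℕ} {V : Submodule ℝ (Fin n → ℝ)}
    {ι : Matrix (Fin n) (Fin m) ℝ} (hι : IsOrthonormalFrame V ι) {α X Y : Matrix (Fin n) (Fin n) ℝ}
    (hα : α ∈ satakeComponentBoundary V) (hpsd : α.PosSemidef) (h0 : α ≠ 0) (hX : X.PosDef)
    (hY : Y.PosDef) :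
    Real.log (higherBusemannSelberg ι α X Y) =
      (Real.log (Y⁻¹ * α).trace - (m : ℝ)⁻¹ * Real.log (compression ι Y⁻¹).det)
        - (Real.log (X⁻¹ * α).trace - (m : ℝ)⁻¹ * Real.log (compression ι X⁻¹).det) := by
  have ht : ∀ Z : Matrix (Fin n) (Fin n) ℝ, Z.PosDef → (Z⁻¹ * α).trace ≠ 0 := fun Z hZ =>
    (trace_posDef_mul_pos hZ.inv hpsd h0).ne'
  have hd : ∀ Z : Matrix (Fin n) (Fin n) ℝ, Z.PosDef → 0 < (compression ι Z⁻¹).det := fun Z hZ =>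
    (compression_posDef hι hZ.inv).det_pos
  have hi : ∀ Z : Matrix (Fin n) (Fin n) ℝ, Z.PosDef →
      ((compression ι Z⁻¹).det ^ ((m : ℝ)⁻¹))⁻¹ ≠ 0 := fun Z hZ =>
    (inv_pos.mpr (Real.rpow_pos_of_pos (hd Z hZ) _)).ne'
  rw [higherBusemannSelberg_eq hι hα hX hY,
    Real.log_div (mul_ne_zero (ht Y hY) (hi Y hY)) (mul_ne_zero (ht X hX) (hi X hX)),
    Real.log_mul (ht Y hY) (hi Y hY), Real.log_mul (ht X hX) (hi X hX), Real.log_inv, Real.log_inv,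
    Real.log_rpow (hd Y hY), Real.log_rpow (hd X hX)]
  ring

/-- For a boundary component `Π = ∂_S(V)` of type `n - k` (with `V` the whole space when `k = 0`), a
point `α` on its boundary, any orthonormal frame `ι` of `V` and any reference point `X`, the
logarithm of the type-`k` Busemann–Selberg function is `√((n-k-1)/(n-k))`-Lipschitz. -/
theorem proposition3p4 (n k : ℕ) (hk : k ≤ n)
    (V : Submodule ℝ (Fin n → ℝ)) (hV : Module.finrank ℝ V = n - k)
    (ι : Matrix (Fin n) (Fin (n - k)) ℝ) (hι : IsOrthonormalFrame V ι)
    (α : Matrix (Fin n) (Fin n) ℝ) (hα : α ∈ satakeComponentBoundary V)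
    (X : Matrix (Fin n) (Fin n) ℝ) (hX : X ∈ symSpace n)
    (Y₁ : Matrix (Fin n) (Fin n) ℝ) (hY₁ : Y₁ ∈ symSpace n)
    (Y₂ : Matrix (Fin n) (Fin n) ℝ) (hY₂ : Y₂ ∈ symSpace n) :
    |Real.log (higherBusemannSelberg ι α X Y₁) - Real.log (higherBusemannSelberg ι α X Y₂)|
      ≤ √(((n : ℝ) - k - 1) / ((n : ℝ) - k)) * symSpaceDist Y₁ Y₂ := by
  obtain ⟨-, hc0, hια⟩ := compression_boundary hι hα
  have h0 : α ≠ 0 := by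
    rintro rfl
    exact hc0 (by simp [compression])
  -- If `n - k = 0`, the compression of `α` is an empty matrix, hence zero.
  have hm : n - k ≠ 0 := by
    intro hm
    have : IsEmpty (Fin (n - k)) := by rw [hm]; infer_instance
    exact hc0 (Subsingleton.elim _ _)
  have hpsd : α.PosSemidef := by
    simp only [satakeComponentBoundary, mem_iUnion] at hα
    obtain ⟨W, -, -, hW⟩ := hα
    exact hW.1
  -- The nonnegative constant is moved inside the infimum, so each path can be bounded separately.
  rw [log_higherBusemannSelberg hι hα hpsd h0 hX.1 hY₁.1,
    log_higherBusemannSelberg hι hα hpsd h0 hX.1 hY₂.1, sub_sub_sub_cancel_right,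
    ← Nat.cast_sub hk, symSpaceDist, ← smul_eq_mul (√_), ← Real.sInf_smul_of_nonneg (Real.sqrt_nonneg _)]
  -- Some path must exist, since the real `sInf` of the empty set is 0.
  obtain ⟨γ₀, hγ₀⟩ := exists_isSymSpacePath hY₁ hY₂
  refine le_csInf (Set.Nonempty.smul_set ⟨_, γ₀, hγ₀, rfl⟩) ?_
  rintro _ ⟨_, ⟨γ, hγ, rfl⟩, rfl⟩
  exact hγ.abs_sub_le_length hm hι hpsd h0 hια
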